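/- Let $n\ge 0$ and let $M$ be the set of all Lebesgue measurable functions $f:\mathbb{R}^n\to[0,1]$ (functions, not equivalence classes), with the supremum metric $d_\infty(f,g)=\sup_{x\in\mathbb{R}^n}|f(x)-g(x)|$. Let $K\in L^1(\mathbb{R}^n)$ be real-valued and let $G:\mathbb{R}\to\mathbb{R}$ be bounded and Lipschitz continuous. Write $[y]_0^1=\min\{\max\{0,y\},1\}$ and $(K*f)(x)=\int_{\mathbb{R}^n}K(y)f(x-y)\,dy$, and for $t\in[0,1]$ and $f\in M$ put $$X_t(f)(x):=\bigl[f(x)+t\,G\bigl((K*f)(x)\bigr)\bigr]_0^1 .$$ Then $(M,d_\infty)$ is a complete metric space, and $X:M\times[0,1]\to M$ is an arc field on it, that is, $X$ is well defined and jointly continuous and $X_0(f)=f$ for all $f\in M$. Moreover: 1. (Condition E1) For every $f_0\in M$ there are $r>0$, $\delta>0$ and $\Lambda\in\mathbb{R}$ such that for all $f,g$ in the ball $B(f_0,r)$ and all $t\in[0,1]$ with $t<\delta$, $$d_\infty(X_t(f),X_t(g))\le(1+t\Lambda)\,d_\infty(f,g).$$ 2. (Condition E2) For every $f_0\in M$ there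 are $r>0$, $\delta>0$ and $\Omega\in\mathbb{R}$ such that for all $f\in B(f_0,r)$ and all $0\le t\le s<\delta$ with $s+t\le 1$, $$d_\infty\bigl(X_{s+t}(f),X_t(X_s(f))\bigr)\le st\,\Omega.$$ 3. There is a unique forward flow $F$ that is forward tangent to $X$, that is, a unique continuous map $F:M\times[0,\infty)\to M$ such that $F_0(f)=f$ and $F_t(F_s(f))=F_{s+t}(f)$ for all $s,t\ge0$ and $f\in M$, and $$\lim_{h\to0^+}\frac{d_\infty\bigl(F_{t+h}(f),X_h(F_t(f))\bigr)}{h}=0\qquad\text{for all }t\ge0,\ f\in M.$$ 4. For all $t\ge0$ and $f\in M$, $$F_t(f)=\lim_{m\to\infty}X_{t/m}^{(m)}(f)\quad\text{in }(M,d_\infty),$$ where $X_\tau^{(m)}$ denotes the $m$-fold composition of $X_\tau$ with itself (defined for $m\ge\max\{t,1\}$). -/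

import Mathlib

open MeasureTheory Filter Topology
open scoped NNReal unitInterval

noncomputable section

/-! ### Arc fields and flows on a metric space -/

section ArcFields

variable {M : Type*} [MetricSpace M]

/-- `X : M × [0,1] → M`, written `X t f`, is an arc field: it is jointly continuous and
`X_0 = id`. -/
structure IsArcField (X : I → M → M) : Prop where
  continuous : Continuous fun p : M × I => X p.2 p.1
  zero : ∀ f, X 0 f = f

/-- Condition E1. -/
def CondE1 (X : I → M → M) : Prop :=
  ∀ f₀ : M, ∃ r > (0 : ℝ), ∃ δ > (0 : ℝ), ∃ Λ : ℝ,
    ∀ f ∈ Metric.ball f₀ r, ∀ g ∈ Metric.ball f₀ r, ∀ t : I, (t : ℝ) < δ →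
      dist (X t f) (X t g) ≤ (1 + t * Λ) * dist f g

/-- Condition E2. The time `u = s + t` ranges over `[0,1]`, where the arc field is defined. -/
def CondE2 (X : I → M → M) : Prop :=
  ∀ f₀ : M, ∃ r > (0 : ℝ), ∃ δ > (0 : ℝ), ∃ Ω : ℝ,
    ∀ f ∈ Metric.ball f₀ r, ∀ s t u : I, t ≤ s → (s : ℝ) < δ → (u : ℝ) = s + t →
      dist (X u f) (X t (X s f)) ≤ s * t * Ω

/-- `F : M × [0,∞) → M`, written `F t f`, is a forward flow. -/
structure IsForwardFlow (F : ℝ≥0 → M → M) : Prop where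
  continuous : Continuous fun p : M × ℝ≥0 => F p.2 p.1
  zero : ∀ f, F 0 f = f
  add : ∀ s t f, F t (F s f) = F (s + t) f

/-- `F` is forward tangent to `X`. -/
def IsForwardTangent (F : ℝ≥0 → M → M) (X : I → M → M) : Prop :=
  ∀ (t : ℝ≥0) (f : M),
    Tendsto (fun h : I => dist (F (t + unitInterval.toNNReal h) f) (X h (F t f)) / (h : ℝ))
      (𝓝[>] 0) (𝓝 0)

/-- `F` is a flow of the arc field `X`. -/
def IsFlowOf (F : ℝ≥0 → M → M) (X : I → M → M) : Prop :=
  IsForwardFlow F ∧ IsForwardTangent F X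

/-- The Euler iterate `X_{t/n}^{(n)} f`. It is meaningful for `n ≥ max t 1`, where `t / n` lies
in `[0,1]`; for the finitely many smaller `n` the step is replaced by its projection to `[0,1]`. -/
def eulerIterate (X : I → M → M) (t : ℝ≥0) (n : ℕ) (f : M) : M :=
  (X (Set.projIcc 0 1 zero_le_one ((t : ℝ) / n)))^[n] f

end ArcFields

/-! ### The Lenia space and the Lenia arc field -/

/-- The Lebesgue measurable functions `ℝⁿ → [0,1]` (functions, not classes of functions).
`NullMeasurable` is measurability for the completion of the Borel σ-algebra, that is, for the
Lebesgue σ-algebra. -/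
structure LeniaSpace (n : ℕ) where
  toFun : EuclideanSpace ℝ (Fin n) → ℝ
  measurable' : NullMeasurable toFun volume
  mem_Icc' : ∀ x, toFun x ∈ Set.Icc (0 : ℝ) 1

namespace LeniaSpace

variable {n : ℕ}

instance : CoeFun (LeniaSpace n) fun _ => EuclideanSpace ℝ (Fin n) → ℝ := ⟨toFun⟩

theorem ext' {f g : LeniaSpace n} (h : ∀ x, f x = g x) : f = g := by
  cases f; cases g
  congr
  exact funext h

/-- The supremum metric. -/
instance : Dist (LeniaSpace n) := ⟨fun f g => ⨆ x, |f x - g x|⟩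

theorem dist_def (f g : LeniaSpace n) : dist f g = ⨆ x, |f x - g x| := rfl

theorem bddAbove_abs_sub (f g : LeniaSpace n) : BddAbove (Set.range fun x => |f x - g x|) := by
  refine ⟨1, ?_⟩
  rintro _ ⟨x, rfl⟩
  have hf := f.mem_Icc' x
  have hg := g.mem_Icc' x
  exact abs_le.2 ⟨by linarith [hf.1, hg.2], by linarith [hf.2, hg.1]⟩

theorem abs_sub_le_dist (f g : LeniaSpace n) (x : EuclideanSpace ℝ (Fin n)) :
    |f x - g x| ≤ dist f g :=
  le_ciSup (bddAbove_abs_sub f g) x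

instance : MetricSpace (LeniaSpace n) where
  dist_self f := by simp [dist_def]
  dist_comm f g := by simp only [dist_def, abs_sub_comm]
  dist_triangle f g h := ciSup_le fun x =>
    (abs_sub_le _ (g x) _).trans (add_le_add (abs_sub_le_dist f g x) (abs_sub_le_dist g h x))
  eq_of_dist_eq_zero {f g} h := ext' fun x => by
    have := abs_sub_le_dist f g x
    rw [h] at this
    exact sub_eq_zero.1 (abs_nonpos_iff.1 this)

end LeniaSpace

/-- The clip function `[x]_a^b`. -/
def clip (a b x : ℝ) : ℝ := min (max a x) b

/-- The convolution `(K ∗ f)(x) = ∫ K(y) f(x - y) dy`. -/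
def convKernel {n : ℕ} (K f : EuclideanSpace ℝ (Fin n) → ℝ) : EuclideanSpace ℝ (Fin n) → ℝ :=
  convolution K f (ContinuousLinearMap.mul ℝ ℝ) volume

theorem aemeasurable_convKernel {n : ℕ} {K : EuclideanSpace ℝ (Fin n) → ℝ} (hK : Integrable K)
    (f : LeniaSpace n) : AEMeasurable (convKernel K f) :=
  (AEStronglyMeasurable.convolution_integrand (ContinuousLinearMap.mul ℝ ℝ)
    hK.aestronglyMeasurable
    f.measurable'.aemeasurable.aestronglyMeasurable).integral_prod_right'.aemeasurable

/-- The Lenia arc field `X_t(f)(x) = [f(x) + t G((K ∗ f)(x))]_0^1`. The hypotheses on `K` and `G`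
serve to show that `X_t(f)` is measurable. -/
def leniaArcField {n : ℕ} (K : EuclideanSpace ℝ (Fin n) → ℝ) (hK : Integrable K)
    (G : ℝ → ℝ) (hG : Continuous G) (t : I) (f : LeniaSpace n) : LeniaSpace n where
  toFun x := clip 0 1 (f x + t * G (convKernel K f x))
  measurable' := by
    have h1 : AEMeasurable f.toFun volume := f.measurable'.aemeasurable
    have h2 : AEMeasurable (fun x => G (convKernel K f x)) volume :=
      hG.measurable.comp_aemeasurable (aemeasurable_convKernel hK f)
    have h3 : AEMeasurable (fun x => clip 0 1 (f x + t * G (convKernel K f x))) volume :=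
      (aemeasurable_const.max (h1.add (h2.const_mul _))).min aemeasurable_const
    exact h3.nullMeasurable
  mem_Icc' x := ⟨le_min (le_max_left _ _) zero_le_one, min_le_right _ _⟩

end

/-! A step-by-step error analysis of the Euler scheme. By E1 the iterates of `X_h` amplify errors by
at most `e ^ (C T)` up to time `T`, and by E2 replacing one step of length `h` by `k` steps of
length `h / k` costs `O(h²)`. Hence all schemes of mesh at most `h` agree up to `O(T h)`, so they
converge to a limit `F`, which is at distance `O(h²)` from `X_h` after time `h`. Running schemes of
mesh `1 / n` for `⌊s n⌋` and then `⌊t n⌋` steps shows that `F` is a semigroup. Two curves tangent to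
`X` separate at most at the rate `C`, so Grönwall's inequality gives uniqueness.

For the Lenia field, `f ↦ G(K ∗ f)` is Lipschitz in the supremum metric since `|K ∗ f| ≤ ‖K‖₁`
keeps `G` on a compact interval. The clip costs nothing: moving twice at a fixed velocity with a
clip after each move is one clipped move, so E2 only sees the change of the velocity. -/

section Iterates

theorem dist_iterate_iterate_le {α : Type*} [PseudoMetricSpace α] {S T : α → α} {c : ℝ≥0} {ε : ℝ}
    (hS : LipschitzWith c S) (h : ∀ x, dist (S x) (T x) ≤ ε) (n : ℕ) (x : α) :
    dist (S^[n] x) (T^[n] x) ≤ (∑ i ∈ Finset.range n, (c : ℝ) ^ i) * ε := by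
  induction n with
  | zero => simp
  | succ n ih =>
    rw [Function.iterate_succ_apply', Function.iterate_succ_apply', geom_sum_succ]
    calc dist (S (S^[n] x)) (T (T^[n] x))
        ≤ dist (S (S^[n] x)) (S (T^[n] x)) + dist (S (T^[n] x)) (T (T^[n] x)) :=
          dist_triangle _ _ _
      _ ≤ c * ((∑ i ∈ Finset.range n, (c : ℝ) ^ i) * ε) + ε := by
          gcongr
          · exact (hS.dist_le_mul _ _).trans (by gcongr)
          · exact h _
      _ = (c * ∑ i ∈ Finset.range n, (c : ℝ) ^ i + 1) * ε := by ring

theorem one_add_pow_le_exp {x : ℝ} (hx : -1 ≤ x) (n : ℕ) : (1 + x) ^ n ≤ Real.exp (n * x) := by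
  rw [Real.exp_nat_mul, add_comm]
  exact pow_le_pow_left₀ (by linarith) (Real.add_one_le_exp x) n

theorem geom_sum_one_add_le {x : ℝ} (hx : 0 ≤ x) (n : ℕ) :
    ∑ i ∈ Finset.range n, (1 + x) ^ i ≤ n * Real.exp (n * x) := by
  have hterm : ∀ i ∈ Finset.range n, (1 + x) ^ i ≤ Real.exp (n * x) := fun i hi =>
    (pow_le_pow_right₀ (by linarith) (Finset.mem_range.1 hi).le).trans
      (one_add_pow_le_exp (by linarith) n)
  simpa using Finset.sum_le_card_nsmul _ _ _ hterm

end Iterates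

section EulerStep

/-- The step size `t / n` of the `n`-step Euler scheme up to time `t`, projected to `[0,1]`. -/
noncomputable def eulerStep (t : ℝ≥0) (n : ℕ) : I := Set.projIcc 0 1 zero_le_one ((t : ℝ) / n)

theorem eulerIterate_eq_iterate {M : Type*} (X : I → M → M) (t : ℝ≥0) (n : ℕ) (f : M) :
    eulerIterate X t n f = (X (eulerStep t n))^[n] f :=
  rfl

theorem eulerStep_zero (n : ℕ) : eulerStep 0 n = 0 := by
  simp [eulerStep]

theorem coe_eulerStep {t : ℝ≥0} {n : ℕ} (htn : t ≤ n) : (eulerStep t n : ℝ) = t / n := by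
  have hmem : (t : ℝ) / n ∈ I :=
    ⟨by positivity, div_le_one_of_le₀ (mod_cast htn) n.cast_nonneg⟩
  rw [eulerStep, Set.projIcc_of_mem zero_le_one hmem]

theorem natCast_mul_coe_eulerStep {t : ℝ≥0} {n : ℕ} (htn : t ≤ n) :
    (n : ℝ) * eulerStep t n = t := by
  rcases eq_or_ne n 0 with rfl | hn
  · simp_all
  · rw [coe_eulerStep htn, mul_div_cancel₀ _ (Nat.cast_ne_zero.2 hn)]

theorem tendsto_eulerStep (t : ℝ≥0) : Tendsto (eulerStep t) atTop (𝓝 0) := by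
  have hproj : Tendsto (Set.projIcc (0 : ℝ) 1 zero_le_one) (𝓝 0) (𝓝 0) := by
    simpa using (continuous_projIcc (h := zero_le_one' ℝ)).tendsto 0
  exact hproj.comp (tendsto_const_div_atTop_nhds_zero_nat _)

theorem eventually_le_natCast (t : ℝ≥0) : ∀ᶠ n : ℕ in atTop, t ≤ n :=
  tendsto_natCast_atTop_atTop.eventually_ge_atTop t

theorem tendsto_floor_mul_eulerStep_one (t : ℝ≥0) :
    Tendsto (fun n : ℕ => ⌊(t : ℝ) * n⌋₊ * unitInterval.toNNReal (eulerStep 1 n)) atTop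
      (𝓝 t) := by
  have hfloor := (tendsto_nat_floor_mul_div_atTop t.2).comp tendsto_natCast_atTop_atTop
  refine NNReal.tendsto_coe.1 (hfloor.congr' ?_)
  filter_upwards [eventually_le_natCast 1] with n hn
  simp [coe_eulerStep hn, div_eq_mul_inv]

end EulerStep

section UniformArcField

variable {M : Type*} [MetricSpace M]

/-- An arc field that satisfies E1 and E2 on the whole space with the constants `C` and `Ω`, and
whose arcs have speed at most `B`. -/
structure IsUniformArcField (X : I → M → M) (C B Ω : ℝ≥0) : Prop where
  zero : ∀ f, X 0 f = f
  lipschitzWith : ∀ t, LipschitzWith (1 + unitInterval.toNNReal t * C) (X t)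
  lipschitzWith_time : ∀ f, LipschitzWith B fun t => X t f
  dist_comp_le : ∀ (s t u : I) (f : M), (u : ℝ) = s + t →
    dist (X u f) (X t (X s f)) ≤ s * t * Ω

/-- The limit of the Euler iterates of `X`, which for a uniform arc field on a complete space is its
flow; a junk value where the iterates do not converge. -/
noncomputable def eulerFlow (X : I → M → M) (t : ℝ≥0) (f : M) : M :=
  haveI : Nonempty M := ⟨f⟩
  limUnder atTop fun n => eulerIterate X t n f

namespace IsUniformArcField

variable {X : I → M → M} {C B Ω : ℝ≥0}

theorem isArcField (hX : IsUniformArcField X C B Ω) : IsArcField X where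
  continuous := by
    refine continuous_prod_of_continuous_lipschitzWith _ (1 + C)
      (fun f => (hX.lipschitzWith_time f).continuous) fun t => (hX.lipschitzWith t).weaken ?_
    gcongr
    exact mul_le_of_le_one_left' t.2.2
  zero := hX.zero

theorem condE1 (hX : IsUniformArcField X C B Ω) : CondE1 X := fun _ =>
  ⟨1, one_pos, 1, one_pos, C, fun f _ g _ t _ => (hX.lipschitzWith t).dist_le_mul f g⟩

theorem condE2 (hX : IsUniformArcField X C B Ω) : CondE2 X := fun _ =>
  ⟨1, one_pos, 1, one_pos, Ω, fun f _ s t u _ _ hu => hX.dist_comp_le s t u f hu⟩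

theorem dist_iterate_le (hX : IsUniformArcField X C B Ω) (h : I) (k : ℕ) (f g : M) :
    dist ((X h)^[k] f) ((X h)^[k] g) ≤ Real.exp (C * (k * h)) * dist f g := by
  have hCh : (0 : ℝ) ≤ h * C := mul_nonneg h.2.1 C.2
  calc dist ((X h)^[k] f) ((X h)^[k] g) ≤ (1 + h * C) ^ k * dist f g := by
        simpa using ((hX.lipschitzWith h).iterate k).dist_le_mul f g
    _ ≤ Real.exp (k * (h * C)) * dist f g := by
        gcongr
        exact one_add_pow_le_exp (by linarith) k
    _ = Real.exp (C * (k * h)) * dist f g := by congr 2; ring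

theorem dist_iterate_iterate_le (hX : IsUniformArcField X C B Ω) (h : I) {T : M → M} {ε : ℝ}
    (hT : ∀ f, dist (X h f) (T f) ≤ ε) (k : ℕ) (f : M) :
    dist ((X h)^[k] f) (T^[k] f) ≤ k * ε * Real.exp (C * (k * h)) := by
  have hε : 0 ≤ ε := dist_nonneg.trans (hT f)
  calc dist ((X h)^[k] f) (T^[k] f)
      ≤ (∑ i ∈ Finset.range k, (1 + (h : ℝ) * C) ^ i) * ε := by
        simpa using _root_.dist_iterate_iterate_le (hX.lipschitzWith h) hT k f
    _ ≤ k * Real.exp (k * (h * C)) * ε := by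
        gcongr
        exact geom_sum_one_add_le (mul_nonneg h.2.1 C.2) k
    _ = k * ε * Real.exp (C * (k * h)) := by
        rw [show (k : ℝ) * (h * C) = C * (k * h) by ring]
        ring

theorem dist_apply_iterate_le_mul_pow (hX : IsUniformArcField X C B Ω) {h u : I} {k : ℕ}
    (hu : (u : ℝ) = k * h) (f : M) :
    dist (X u f) ((X h)^[k] f) ≤ Ω * u ^ 2 * (1 + h * C) ^ k := by
  induction k generalizing u with
  | zero =>
    obtain rfl : u = 0 := Subtype.ext (by simpa using hu)
    simp [hX.zero]
  | succ k ih =>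
    have hh : (0 : ℝ) ≤ h := h.2.1
    have hu' : (u : ℝ) = k * h + h := by rw [hu]; push_cast; ring
    let v : I := ⟨k * h, by positivity, by linarith [u.2.2]⟩
    have hcomp := hX.dist_comp_le v h u f hu'
    have hlip := (hX.lipschitzWith h).dist_le_mul (X v f) ((X h)^[k] f)
    have hone : 1 ≤ (1 + (h : ℝ) * C) ^ (k + 1) :=
      one_le_pow₀ (le_add_of_nonneg_right (by positivity))
    rw [Function.iterate_succ_apply']
    calc dist (X u f) (X h ((X h)^[k] f))
        ≤ dist (X u f) (X h (X v f)) + dist (X h (X v f)) (X h ((X h)^[k] f)) :=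
          dist_triangle _ _ _
      _ ≤ k * h * h * Ω * (1 + h * C) ^ (k + 1)
          + (1 + h * C) * (Ω * (k * h) ^ 2 * (1 + h * C) ^ k) := by
          refine add_le_add (hcomp.trans (le_mul_of_one_le_right (by positivity) hone))
            (hlip.trans (mul_le_mul_of_nonneg_left (ih rfl) (by positivity)))
      _ = Ω * ((k * h) * (k * h + h)) * (1 + h * C) ^ (k + 1) := by ring
      _ ≤ Ω * u ^ 2 * (1 + h * C) ^ (k + 1) := by
          rw [hu', sq]
          gcongr
          exact le_add_of_nonneg_right hh

theorem dist_apply_iterate_le (hX : IsUniformArcField X C B Ω) {h u : I} {k : ℕ}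
    (hu : (u : ℝ) = k * h) (f : M) :
    dist (X u f) ((X h)^[k] f) ≤ Ω * u ^ 2 * Real.exp C := by
  have hCh : (0 : ℝ) ≤ h * C := mul_nonneg h.2.1 C.2
  refine (hX.dist_apply_iterate_le_mul_pow hu f).trans ?_
  gcongr
  refine (one_add_pow_le_exp (by linarith) k).trans (Real.exp_le_exp.2 ?_)
  rw [← mul_assoc, ← hu]
  exact mul_le_of_le_one_left C.2 u.2.2

theorem dist_iterate_refinement_le (hX : IsUniformArcField X C B Ω) {h h' : I} {k : ℕ}
    (hh : (h : ℝ) = k * h') (n : ℕ) (f : M) :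
    dist ((X h)^[n] f) ((X h')^[k * n] f) ≤ Ω * (n * h) * h * Real.exp (C * (n * h + 1)) := by
  rw [Function.iterate_mul]
  calc dist ((X h)^[n] f) (((X h')^[k])^[n] f)
      ≤ n * (Ω * h ^ 2 * Real.exp C) * Real.exp (C * (n * h)) :=
        hX.dist_iterate_iterate_le h (fun g => hX.dist_apply_iterate_le hh g) n f
    _ = Ω * (n * h) * h * (Real.exp (C * (n * h)) * Real.exp C) := by ring
    _ = Ω * (n * h) * h * Real.exp (C * (n * h + 1)) := by rw [← Real.exp_add, mul_add_one]

theorem dist_eulerIterate_mul_le (hX : IsUniformArcField X C B Ω) {t : ℝ≥0} {n k : ℕ}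
    (htn : t ≤ n) (hk : k ≠ 0) (f : M) :
    dist (eulerIterate X t n f) (eulerIterate X t (k * n) f)
      ≤ Ω * t ^ 2 * Real.exp (C * (t + 1)) / n := by
  have htkn : t ≤ (k * n : ℕ) :=
    htn.trans (mod_cast Nat.le_mul_of_pos_left n (Nat.pos_of_ne_zero hk))
  have hstep : (eulerStep t n : ℝ) = k * eulerStep t (k * n) := by
    rw [coe_eulerStep htn, coe_eulerStep htkn]
    push_cast
    rw [← mul_div_assoc, mul_div_mul_left _ _ (Nat.cast_ne_zero.2 hk)]
  have hdist := hX.dist_iterate_refinement_le hstep n f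
  rw [natCast_mul_coe_eulerStep htn, coe_eulerStep htn] at hdist
  exact hdist.trans_eq (by ring)

theorem cauchySeq_eulerIterate (hX : IsUniformArcField X C B Ω) (t : ℝ≥0) (f : M) :
    CauchySeq fun n => eulerIterate X t n f := by
  refine Metric.cauchySeq_iff.2 fun ε hε => ?_
  let A := Ω * (t : ℝ) ^ 2 * Real.exp (C * (t + 1))
  have hA : ∀ᶠ n : ℕ in atTop, A / n < ε / 2 :=
    (tendsto_const_div_atTop_nhds_zero_nat A).eventually_lt_const (half_pos hε)
  obtain ⟨N, hN⟩ := eventually_atTop.1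
    (hA.and ((eventually_le_natCast t).and (eventually_ne_atTop 0)))
  refine ⟨N, fun m hm n hn => ?_⟩
  obtain ⟨hAm, htm, hm0⟩ := hN m hm
  obtain ⟨hAn, htn, hn0⟩ := hN n hn
  have hmn := hX.dist_eulerIterate_mul_le htm hn0 f
  have hnm := hX.dist_eulerIterate_mul_le htn hm0 f
  rw [mul_comm n m] at hmn
  linarith [dist_triangle_right (eulerIterate X t m f) (eulerIterate X t n f)
    (eulerIterate X t (m * n) f)]

theorem dist_eulerIterate_time_le (hX : IsUniformArcField X C B Ω) {s t : ℝ≥0} {n : ℕ}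
    (hsn : s ≤ n) (htn : t ≤ n) (f : M) :
    dist (eulerIterate X s n f) (eulerIterate X t n f) ≤ B * dist s t * Real.exp (C * s) := by
  have hsteps : (n : ℝ) * dist (eulerStep s n) (eulerStep t n) = dist s t := by
    rw [Subtype.dist_eq, Real.dist_eq, ← Nat.abs_cast n, ← abs_mul, mul_sub,
      natCast_mul_coe_eulerStep hsn, natCast_mul_coe_eulerStep htn, NNReal.dist_eq]
  calc dist (eulerIterate X s n f) (eulerIterate X t n f)
      ≤ n * (B * dist (eulerStep s n) (eulerStep t n)) * Real.exp (C * (n * eulerStep s n)) :=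
        hX.dist_iterate_iterate_le _ (fun g => (hX.lipschitzWith_time g).dist_le_mul _ _) n f
    _ = B * dist s t * Real.exp (C * s) := by
        rw [natCast_mul_coe_eulerStep hsn, mul_left_comm, hsteps]

variable [CompleteSpace M]

theorem tendsto_eulerIterate (hX : IsUniformArcField X C B Ω) (t : ℝ≥0) (f : M) :
    Tendsto (fun n => eulerIterate X t n f) atTop (𝓝 (eulerFlow X t f)) :=
  haveI : Nonempty M := ⟨f⟩
  (hX.cauchySeq_eulerIterate t f).tendsto_limUnder

theorem eulerFlow_zero (hX : IsUniformArcField X C B Ω) (f : M) : eulerFlow X 0 f = f := by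
  refine tendsto_nhds_unique (hX.tendsto_eulerIterate 0 f) (tendsto_const_nhds.congr fun n => ?_)
  rw [eulerIterate_eq_iterate, eulerStep_zero, Function.iterate_fixed (hX.zero f)]

theorem dist_eulerFlow_le (hX : IsUniformArcField X C B Ω) (t : ℝ≥0) (f g : M) :
    dist (eulerFlow X t f) (eulerFlow X t g) ≤ Real.exp (C * t) * dist f g := by
  refine le_of_tendsto ((hX.tendsto_eulerIterate t f).dist (hX.tendsto_eulerIterate t g)) ?_
  filter_upwards [eventually_le_natCast t] with n htn
  simpa only [eulerIterate_eq_iterate, natCast_mul_coe_eulerStep htn]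
    using hX.dist_iterate_le (eulerStep t n) n f g

theorem dist_eulerFlow_time_le (hX : IsUniformArcField X C B Ω) (s t : ℝ≥0) (f : M) :
    dist (eulerFlow X s f) (eulerFlow X t f) ≤ B * dist s t * Real.exp (C * s) := by
  refine le_of_tendsto ((hX.tendsto_eulerIterate s f).dist (hX.tendsto_eulerIterate t f)) ?_
  filter_upwards [eventually_le_natCast s, eventually_le_natCast t] with n hsn htn
  exact hX.dist_eulerIterate_time_le hsn htn f

theorem continuous_eulerFlow (hX : IsUniformArcField X C B Ω) :
    Continuous fun p : M × ℝ≥0 => eulerFlow X p.2 p.1 := by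
  refine continuous_iff_continuousAt.2 fun ⟨f₀, t₀⟩ => tendsto_iff_dist_tendsto_zero.2 ?_
  have hbound : Continuous fun p : M × ℝ≥0 =>
      Real.exp (C * p.2) * dist p.1 f₀ + B * dist p.2 t₀ * Real.exp (C * p.2) := by
    fun_prop
  refine squeeze_zero (fun _ => dist_nonneg) (fun p => ?_)
    (by simpa using hbound.tendsto (f₀, t₀))
  exact (dist_triangle _ (eulerFlow X p.2 f₀) _).trans
    (add_le_add (hX.dist_eulerFlow_le _ _ _) (hX.dist_eulerFlow_time_le _ _ _))

theorem dist_iterate_eulerFlow_le (hX : IsUniformArcField X C B Ω) (h : I) (k : ℕ) (f : M) :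
    dist ((X h)^[k] f) (eulerFlow X (k * unitInterval.toNNReal h) f)
      ≤ Ω * (k * h) * h * Real.exp (C * (k * h + 1)) := by
  rcases eq_or_ne k 0 with rfl | hk
  · simp [hX.eulerFlow_zero]
  set t : ℝ≥0 := k * unitInterval.toNNReal h with ht
  have hmul : Tendsto (fun m : ℕ => m * k) atTop atTop :=
    tendsto_id.atTop_mul_const' (Nat.pos_of_ne_zero hk)
  refine le_of_tendsto (tendsto_const_nhds.dist ((hX.tendsto_eulerIterate t f).comp hmul)) ?_
  filter_upwards [eventually_ne_atTop 0] with m hm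
  have htk : t ≤ k := mul_le_of_le_one_right' h.2.2
  have htmk : t ≤ (m * k : ℕ) :=
    htk.trans (mod_cast Nat.le_mul_of_pos_left k (Nat.pos_of_ne_zero hm))
  have hstep : (h : ℝ) = m * eulerStep t (m * k) := by
    rw [coe_eulerStep htmk, ht]
    push_cast
    rw [unitInterval.coe_toNNReal]
    field_simp
  exact hX.dist_iterate_refinement_le hstep k f

theorem tendsto_iterate_eulerFlow (hX : IsUniformArcField X C B Ω) {ι : Type*} {l : Filter ι}
    {h : ι → I} {k : ι → ℕ} {g : ι → M} {t : ℝ≥0} {f : M} (hh : Tendsto h l (𝓝 0))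
    (hk : Tendsto (fun i => k i * unitInterval.toNNReal (h i)) l (𝓝 t)) (hg : Tendsto g l (𝓝 f)) :
    Tendsto (fun i => (X (h i))^[k i] (g i)) l (𝓝 (eulerFlow X t f)) := by
  have hflow : Tendsto (fun i => eulerFlow X (k i * unitInterval.toNNReal (h i)) (g i)) l
      (𝓝 (eulerFlow X t f)) := by
    simpa only [Function.comp_def] using
      (hX.continuous_eulerFlow.tendsto (f, t)).comp (hg.prodMk_nhds hk)
  refine (tendsto_iff_of_dist ?_).2 hflow
  have hbound : Continuous fun p : ℝ≥0 × I =>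
      Ω * (p.1 : ℝ) * p.2 * Real.exp (C * (p.1 + 1)) := by
    fun_prop
  refine squeeze_zero (fun _ => dist_nonneg)
    (fun i => hX.dist_iterate_eulerFlow_le (h i) (k i) (g i)) ?_
  simpa [Function.comp_def] using (hbound.tendsto (t, 0)).comp (hk.prodMk_nhds hh)

theorem eulerFlow_add (hX : IsUniformArcField X C B Ω) (s t : ℝ≥0) (f : M) :
    eulerFlow X t (eulerFlow X s f) = eulerFlow X (s + t) f := by
  have hh := tendsto_eulerStep 1
  have hs := tendsto_floor_mul_eulerStep_one s
  have ht := tendsto_floor_mul_eulerStep_one t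
  have hiterated := hX.tendsto_iterate_eulerFlow hh ht
    (hX.tendsto_iterate_eulerFlow hh hs (tendsto_const_nhds (x := f)))
  have hjoint := hX.tendsto_iterate_eulerFlow 
    (k := fun n : ℕ => ⌊(t : ℝ) * n⌋₊ + ⌊(s : ℝ) * n⌋₊) hh
    (by simpa only [Nat.cast_add, add_mul] using ht.add hs) (tendsto_const_nhds (x := f))
  simp only [Function.iterate_add_apply, add_comm t s] at hjoint
  exact tendsto_nhds_unique hiterated hjoint

theorem isForwardFlow_eulerFlow (hX : IsUniformArcField X C B Ω) :
    IsForwardFlow (eulerFlow X) where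
  continuous := hX.continuous_eulerFlow
  zero := hX.eulerFlow_zero
  add := hX.eulerFlow_add

theorem isForwardTangent_eulerFlow (hX : IsUniformArcField X C B Ω) :
    IsForwardTangent (eulerFlow X) X := by
  intro t f
  have hbound : Continuous fun h : I => Ω * (h : ℝ) * Real.exp (C * (h + 1)) := by fun_prop
  refine squeeze_zero' (Eventually.of_forall fun h => div_nonneg dist_nonneg h.2.1) ?_
    (by simpa using (hbound.tendsto 0).mono_left nhdsWithin_le_nhds)
  filter_upwards [self_mem_nhdsWithin] with h hh
  have hone := hX.dist_iterate_eulerFlow_le h 1 (eulerFlow X t f)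
  simp only [Function.iterate_one, Nat.cast_one, one_mul] at hone
  rw [div_le_iff₀ (show (0 : ℝ) < h from hh), ← hX.eulerFlow_add, dist_comm]
  exact hone.trans_eq (by ring)

theorem isFlowOf_eulerFlow (hX : IsUniformArcField X C B Ω) : IsFlowOf (eulerFlow X) X :=
  ⟨hX.isForwardFlow_eulerFlow, hX.isForwardTangent_eulerFlow⟩

end IsUniformArcField

end UniformArcField

section Uniqueness

variable {M : Type*} [MetricSpace M]

/-- A solution curve of an arc field `X`: a continuous curve in `M` that is forward tangent to the
arcs of `X` at all times. -/
structure IsSolutionCurve (X : I → M → M) (γ : ℝ≥0 → M) : Prop where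
  continuous : Continuous γ
  tangent : ∀ t, Tendsto
    (fun h : I => dist (γ (t + unitInterval.toNNReal h)) (X h (γ t)) / (h : ℝ)) (𝓝[>] 0) (𝓝 0)

theorem IsFlowOf.isSolutionCurve {X : I → M → M} {F : ℝ≥0 → M → M} (hF : IsFlowOf F X) (f : M) :
    IsSolutionCurve X fun t => F t f where
  continuous := hF.1.continuous.comp (Continuous.prodMk_right f)
  tangent t := hF.2 t f

theorem tendsto_projIcc_sub_nhdsGT (x : ℝ) :
    Tendsto (fun z : ℝ => Set.projIcc (0 : ℝ) 1 zero_le_one (z - x)) (𝓝[>] x) (𝓝[>] 0) := by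
  refine tendsto_nhdsWithin_iff.2 ⟨?_, ?_⟩
  · have hcont : Continuous fun z : ℝ => Set.projIcc (0 : ℝ) 1 zero_le_one (z - x) :=
      continuous_projIcc.comp (by fun_prop)
    simpa using (hcont.tendsto x).mono_left nhdsWithin_le_nhds
  · filter_upwards [self_mem_nhdsWithin] with z hz
    rw [Set.mem_Ioi, ← Subtype.coe_lt_coe, Set.coe_projIcc]
    simpa using hz

variable {X : I → M → M} {C : ℝ≥0} {γ γ' : ℝ≥0 → M}

theorem IsSolutionCurve.eventually_dist_lt
    (hX : ∀ t, LipschitzWith (1 + unitInterval.toNNReal t * C) (X t))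
    (hγ : IsSolutionCurve X γ) (hγ' : IsSolutionCurve X γ') (t : ℝ≥0) {r : ℝ}
    (hr : C * dist (γ t) (γ' t) < r) :
    ∀ᶠ h : I in 𝓝[>] 0, dist (γ (t + unitInterval.toNNReal h)) (γ' (t + unitInterval.toNNReal h))
      < dist (γ t) (γ' t) + h * r := by
  have herr := (hγ.tangent t).add (hγ'.tangent t)
  rw [add_zero] at herr
  filter_upwards [herr.eventually_lt_const (sub_pos.2 hr), self_mem_nhdsWithin] with h hlt hh
  have hpos : (0 : ℝ) < h := hh
  rw [← add_div, div_lt_iff₀ hpos] at hlt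
  have hlip := (hX h).dist_le_mul (γ t) (γ' t)
  push_cast [unitInterval.coe_toNNReal] at hlip
  have htri := dist_triangle4 (γ (t + unitInterval.toNNReal h)) (X h (γ t)) (X h (γ' t))
    (γ' (t + unitInterval.toNNReal h))
  rw [dist_comm (X h (γ' t))] at htri
  linarith

theorem IsSolutionCurve.eventually_slope_dist_lt
    (hX : ∀ t, LipschitzWith (1 + unitInterval.toNNReal t * C) (X t))
    (hγ : IsSolutionCurve X γ) (hγ' : IsSolutionCurve X γ') {x : ℝ} (hx : 0 ≤ x) {r : ℝ}
    (hr : C * dist (γ x.toNNReal) (γ' x.toNNReal) < r) :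
    ∀ᶠ z in 𝓝[>] x, (z - x)⁻¹ * (dist (γ z.toNNReal) (γ' z.toNNReal)
      - dist (γ x.toNNReal) (γ' x.toNNReal)) < r := by
  filter_upwards [(tendsto_projIcc_sub_nhdsGT x).eventually (hγ.eventually_dist_lt hX hγ' _ hr),
    Ioo_mem_nhdsGT (lt_add_one x)] with z hlt hz
  have hmem : z - x ∈ I := ⟨by linarith [hz.1], by linarith [hz.2]⟩
  have hadd : x.toNNReal + unitInterval.toNNReal ⟨z - x, hmem⟩ = z.toNNReal := by
    apply NNReal.coe_injective
    rw [NNReal.coe_add, unitInterval.coe_toNNReal, Real.coe_toNNReal _ hx,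
      Real.coe_toNNReal _ (hx.trans hz.1.le)]
    ring
  rw [Set.projIcc_of_mem zero_le_one hmem, hadd] at hlt
  rw [inv_mul_lt_iff₀ (sub_pos.2 hz.1)]
  exact sub_left_lt_of_lt_add hlt

theorem IsSolutionCurve.dist_le (hX : ∀ t, LipschitzWith (1 + unitInterval.toNNReal t * C) (X t))
    (hγ : IsSolutionCurve X γ) (hγ' : IsSolutionCurve X γ') (t : ℝ≥0) :
    dist (γ t) (γ' t) ≤ dist (γ 0) (γ' 0) * Real.exp (C * t) := by
  let d : ℝ → ℝ := fun x => dist (γ x.toNNReal) (γ' x.toNNReal)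
  have hd : Continuous d := (hγ.continuous.comp continuous_real_toNNReal).dist
    (hγ'.continuous.comp continuous_real_toNNReal)
  have hgronwall := le_gronwallBound_of_liminf_deriv_right_le (f' := fun x => C * d x) (ε := 0)
    hd.continuousOn (fun x hx r hr => (hγ.eventually_slope_dist_lt hX hγ' hx.1 hr).frequently)
    le_rfl (fun x _ => (add_zero _).ge) t (Set.right_mem_Icc.2 t.2)
  simpa [d, gronwallBound_ε0] using hgronwall

theorem IsFlowOf.unique (hX : ∀ t, LipschitzWith (1 + unitInterval.toNNReal t * C) (X t))
    {F F' : ℝ≥0 → M → M} (hF : IsFlowOf F X) (hF' : IsFlowOf F' X) : F' = F := by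
  funext t f
  have hle := (hF'.isSolutionCurve f).dist_le hX (hF.isSolutionCurve f) t
  simp only [hF'.1.zero, hF.1.zero, dist_self, zero_mul] at hle
  exact dist_le_zero.1 hle

end Uniqueness

section Clip

theorem abs_clip_sub_clip_le (a b x y : ℝ) : |clip a b x - clip a b y| ≤ |x - y| :=
  (abs_min_sub_min_le_max _ _ _ _).trans <| max_le
    ((abs_max_sub_max_le_max _ _ _ _).trans (by simp)) (by simp)

theorem clip_eq_self {a b x : ℝ} (hx : x ∈ Set.Icc a b) : clip a b x = x := by
  rw [clip, max_eq_right hx.1, min_eq_left hx.2]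

theorem clip_clip_add_mul {a b x s t : ℝ} (hx : x ∈ Set.Icc a b) (hs : 0 ≤ s) (ht : 0 ≤ t)
    (v : ℝ) : clip a b (clip a b (x + s * v) + t * v) = clip a b (x + (s + t) * v) := by
  obtain ⟨hax, hxb⟩ := hx
  rw [add_mul, ← add_assoc]
  unfold clip
  rcases le_total 0 v with hv | hv
  · have hsv := mul_nonneg hs hv
    have htv := mul_nonneg ht hv
    grind
  · have hsv := mul_nonpos_of_nonneg_of_nonpos hs hv
    have htv := mul_nonpos_of_nonneg_of_nonpos ht hv
    grind

end Clip

namespace LeniaSpace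

variable {n : ℕ}

theorem dist_le {f g : LeniaSpace n} {c : ℝ} (h : ∀ x, |f x - g x| ≤ c) : dist f g ≤ c :=
  ciSup_le h

theorem abs_le_one (f : LeniaSpace n) (x : EuclideanSpace ℝ (Fin n)) : |f x| ≤ 1 :=
  abs_le.2 ⟨by linarith [(f.mem_Icc' x).1], (f.mem_Icc' x).2⟩

theorem cauchySeq_apply {u : ℕ → LeniaSpace n} (hu : CauchySeq u)
    (x : EuclideanSpace ℝ (Fin n)) : CauchySeq fun k => u k x :=
  (LipschitzWith.of_dist_le_mul (K := 1) (f := fun f : LeniaSpace n => f x) fun f g => by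
    simpa [Real.dist_eq] using abs_sub_le_dist f g x).uniformContinuous.comp_cauchySeq hu

theorem tendsto_of_cauchySeq_of_tendsto_apply {u : ℕ → LeniaSpace n} {g : LeniaSpace n}
    (hu : CauchySeq u) (hg : ∀ x, Tendsto (fun k => u k x) atTop (𝓝 (g x))) :
    Tendsto u atTop (𝓝 g) := by
  refine Metric.tendsto_atTop.2 fun ε hε => ?_
  obtain ⟨N, hN⟩ := Metric.cauchySeq_iff.1 hu (ε / 2) (half_pos hε)
  refine ⟨N, fun k hk => (dist_le fun x => ?_).trans_lt (half_lt_self hε)⟩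
  refine le_of_tendsto ((tendsto_const_nhds.sub (hg x)).abs) ?_
  filter_upwards [eventually_ge_atTop N] with m hm
  exact (abs_sub_le_dist (u k) (u m) x).trans (hN k hk m hm).le

instance : CompleteSpace (LeniaSpace n) := by
  refine Metric.complete_of_cauchySeq_tendsto fun u hu => ?_
  choose g hg using fun x => cauchySeq_tendsto_of_complete (cauchySeq_apply hu x)
  let limit : LeniaSpace n :=
    { toFun := g
      measurable' := (aemeasurable_of_tendsto_metrizable_ae atTop
        (fun k => (u k).measurable'.aemeasurable) (ae_of_all _ hg)).nullMeasurable
      mem_Icc' := fun x => isClosed_Icc.mem_of_tendsto (hg x)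
        (Eventually.of_forall fun k => (u k).mem_Icc' x) }
  exact ⟨limit, tendsto_of_cauchySeq_of_tendsto_apply hu hg⟩

end LeniaSpace

section Convolution

variable {n : ℕ} {K : EuclideanSpace ℝ (Fin n) → ℝ}

/-- The `L¹` norm of a kernel; `0` for a kernel that is not integrable. -/
noncomputable def kernelNorm (K : EuclideanSpace ℝ (Fin n) → ℝ) : ℝ≥0 :=
  ⟨∫ y, ‖K y‖, integral_nonneg fun _ => norm_nonneg _⟩

theorem LeniaSpace.convolutionExistsAt (hK : Integrable K) (f : LeniaSpace n)
    (x : EuclideanSpace ℝ (Fin n)) :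
    ConvolutionExistsAt K f x (ContinuousLinearMap.mul ℝ ℝ) volume :=
  hK.mul_bdd (c := 1) (f.measurable'.aemeasurable.aestronglyMeasurable.comp_quasiMeasurePreserving
    (quasiMeasurePreserving_sub_left volume x)) (ae_of_all _ fun _ => f.abs_le_one _)

theorem abs_convKernel_le (hK : Integrable K) {φ : EuclideanSpace ℝ (Fin n) → ℝ} {c : ℝ}
    (hφ : ∀ y, |φ y| ≤ c) (x : EuclideanSpace ℝ (Fin n)) :
    |convKernel K φ x| ≤ kernelNorm K * c := by
  change ‖∫ y, K y * φ (x - y)‖ ≤ (∫ y, ‖K y‖) * c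
  rw [← integral_mul_const]
  refine norm_integral_le_of_norm_le (hK.norm.mul_const _) (ae_of_all _ fun y => ?_)
  rw [norm_mul]
  exact mul_le_mul_of_nonneg_left (hφ _) (norm_nonneg _)

theorem convKernel_sub {φ ψ : EuclideanSpace ℝ (Fin n) → ℝ} {x : EuclideanSpace ℝ (Fin n)}
    (hφ : ConvolutionExistsAt K φ x (ContinuousLinearMap.mul ℝ ℝ) volume)
    (hψ : ConvolutionExistsAt K ψ x (ContinuousLinearMap.mul ℝ ℝ) volume) :
    convKernel K (φ - ψ) x = convKernel K φ x - convKernel K ψ x := by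
  simpa only [convKernel, convolution, Pi.sub_apply, map_sub] using integral_sub hφ hψ

namespace LeniaSpace

theorem convKernel_mem_closedBall (hK : Integrable K) (f : LeniaSpace n)
    (x : EuclideanSpace ℝ (Fin n)) :
    convKernel K f x ∈ Metric.closedBall 0 (kernelNorm K : ℝ) := by
  simpa using abs_convKernel_le hK f.abs_le_one x

theorem dist_convKernel_le (hK : Integrable K) (f g : LeniaSpace n)
    (x : EuclideanSpace ℝ (Fin n)) :
    dist (convKernel K f x) (convKernel K g x) ≤ kernelNorm K * dist f g := by
  rw [Real.dist_eq, ← convKernel_sub (f.convolutionExistsAt hK x) (g.convolutionExistsAt hK x)]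
  exact abs_convKernel_le hK (abs_sub_le_dist f g) x

end LeniaSpace

end Convolution

section LeniaArcField

open LeniaSpace

variable {n : ℕ} {K : EuclideanSpace ℝ (Fin n) → ℝ} {hK : Integrable K} {G : ℝ → ℝ}
  {hGc : Continuous G} {L B : ℝ≥0}

theorem leniaArcField_apply (t : I) (f : LeniaSpace n) (x : EuclideanSpace ℝ (Fin n)) :
    leniaArcField K hK G hGc t f x = clip 0 1 (f x + t * G (convKernel K f x)) :=
  rfl

theorem leniaArcField_zero (f : LeniaSpace n) : leniaArcField K hK G hGc 0 f = f :=
  ext' fun x => by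
    rw [leniaArcField_apply, Set.Icc.coe_zero, zero_mul, add_zero, clip_eq_self (f.mem_Icc' x)]

theorem dist_growth_le (hK : Integrable K)
    (hG : LipschitzOnWith L G (Metric.closedBall 0 (kernelNorm K))) (f g : LeniaSpace n)
    (x : EuclideanSpace ℝ (Fin n)) :
    |G (convKernel K f x) - G (convKernel K g x)| ≤ L * kernelNorm K * dist f g := by
  rw [← Real.dist_eq, mul_assoc]
  exact (hG.dist_le_mul _ (f.convKernel_mem_closedBall hK x) _
    (g.convKernel_mem_closedBall hK x)).trans
    (mul_le_mul_of_nonneg_left (dist_convKernel_le hK f g x) L.2)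

theorem lipschitzWith_leniaArcField
    (hG : LipschitzOnWith L G (Metric.closedBall 0 (kernelNorm K))) (t : I) :
    LipschitzWith (1 + unitInterval.toNNReal t * (L * kernelNorm K))
      (leniaArcField K hK G hGc t) := by
  refine LipschitzWith.of_dist_le_mul fun f g => LeniaSpace.dist_le fun x => ?_
  calc |leniaArcField K hK G hGc t f x - leniaArcField K hK G hGc t g x|
      ≤ |(f x + t * G (convKernel K f x)) - (g x + t * G (convKernel K g x))| :=
        abs_clip_sub_clip_le _ _ _ _
    _ = |(f x - g x) + t * (G (convKernel K f x) - G (convKernel K g x))| := by congr 1; ring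
    _ ≤ |f x - g x| + t * |G (convKernel K f x) - G (convKernel K g x)| := by
        simpa only [abs_mul, abs_of_nonneg t.2.1] using
          abs_add_le (f x - g x) (t * (G (convKernel K f x) - G (convKernel K g x)))
    _ ≤ dist f g + t * (L * kernelNorm K * dist f g) :=
        add_le_add (abs_sub_le_dist f g x)
          (mul_le_mul_of_nonneg_left (dist_growth_le hK hG f g x) t.2.1)
    _ = (1 + unitInterval.toNNReal t * (L * kernelNorm K) : ℝ≥0) * dist f g := by
        push_cast [unitInterval.coe_toNNReal]
        ring

theorem lipschitzWith_leniaArcField_time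
    (hB : ∀ y ∈ Metric.closedBall 0 (kernelNorm K : ℝ), |G y| ≤ B) (f : LeniaSpace n) :
    LipschitzWith B fun t => leniaArcField K hK G hGc t f := by
  refine LipschitzWith.of_dist_le_mul fun s t => LeniaSpace.dist_le fun x => ?_
  calc |leniaArcField K hK G hGc s f x - leniaArcField K hK G hGc t f x|
      ≤ |(f x + s * G (convKernel K f x)) - (f x + t * G (convKernel K f x))| :=
        abs_clip_sub_clip_le _ _ _ _
    _ = |G (convKernel K f x)| * dist s t := by
        rw [add_sub_add_left_eq_sub, ← sub_mul, abs_mul, mul_comm, Subtype.dist_eq, Real.dist_eq]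
    _ ≤ B * dist s t := by
        gcongr
        exact hB _ (f.convKernel_mem_closedBall hK x)

theorem dist_leniaArcField_comp_le
    (hG : LipschitzOnWith L G (Metric.closedBall 0 (kernelNorm K)))
    (hB : ∀ y ∈ Metric.closedBall 0 (kernelNorm K : ℝ), |G y| ≤ B) {s t u : I}
    (hu : (u : ℝ) = s + t) (f : LeniaSpace n) :
    dist (leniaArcField K hK G hGc u f)
        (leniaArcField K hK G hGc t (leniaArcField K hK G hGc s f))
      ≤ s * t * (L * kernelNorm K * B) := by
  set g := leniaArcField K hK G hGc s f with hg
  have hfg : dist f g ≤ B * s := by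
    simpa [leniaArcField_zero, Subtype.dist_eq, abs_of_nonneg s.2.1] using
      (lipschitzWith_leniaArcField_time (hK := hK) (hGc := hGc) hB f).dist_le_mul 0 s
  refine LeniaSpace.dist_le fun x => ?_
  have hsplit : leniaArcField K hK G hGc u f x = clip 0 1 (g x + t * G (convKernel K f x)) := by
    rw [hg, leniaArcField_apply, leniaArcField_apply,
      clip_clip_add_mul (f.mem_Icc' x) s.2.1 t.2.1, hu]
  calc |leniaArcField K hK G hGc u f x - leniaArcField K hK G hGc t g x|
      ≤ |(g x + t * G (convKernel K f x)) - (g x + t * G (convKernel K g x))| := by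
        rw [hsplit]
        exact abs_clip_sub_clip_le _ _ _ _
    _ = t * |G (convKernel K f x) - G (convKernel K g x)| := by
        rw [add_sub_add_left_eq_sub, ← mul_sub, abs_mul, abs_of_nonneg t.2.1]
    _ ≤ t * (L * kernelNorm K * (B * s)) := by
        refine mul_le_mul_of_nonneg_left ((dist_growth_le hK hG f g x).trans ?_) t.2.1
        gcongr
    _ = s * t * (L * kernelNorm K * B) := by ring

theorem isUniformArcField_leniaArcField
    (hG : LipschitzOnWith L G (Metric.closedBall 0 (kernelNorm K)))
    (hB : ∀ y ∈ Metric.closedBall 0 (kernelNorm K : ℝ), |G y| ≤ B) :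
    IsUniformArcField (leniaArcField K hK G hGc) (L * kernelNorm K) B (L * kernelNorm K * B) where
  zero := leniaArcField_zero
  lipschitzWith := lipschitzWith_leniaArcField hG
  lipschitzWith_time := lipschitzWith_leniaArcField_time hB
  dist_comp_le _ _ _ f hu := dist_leniaArcField_comp_le hG hB hu f

theorem exists_isUniformArcField_leniaArcField (hG : LocallyLipschitz G) :
    ∃ C B Ω, IsUniformArcField (leniaArcField K hK G hGc) C B Ω := by
  have hcompact := isCompact_closedBall (0 : ℝ) (kernelNorm K)
  obtain ⟨L, hL⟩ := hG.locallyLipschitzOn.exists_lipschitzOnWith_of_compact hcompact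
  obtain ⟨B, hB⟩ := hcompact.exists_bound_of_continuousOn hGc.continuousOn
  exact ⟨_, B.toNNReal, _, isUniformArcField_leniaArcField hL fun y hy =>
    (hB y hy).trans B.le_coe_toNNReal⟩

end LeniaArcField

theorem mainTheorem1_general (n : ℕ) (K : EuclideanSpace ℝ (Fin n) → ℝ)
    (hK : Integrable K volume) (G : ℝ → ℝ) (hG : LocallyLipschitz G) :
    CompleteSpace (LeniaSpace n) ∧
    IsArcField (leniaArcField K hK G hG.continuous) ∧
    CondE1 (leniaArcField K hK G hG.continuous) ∧
    CondE2 (leniaArcField K hK G hG.continuous) ∧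
    ∃ F : ℝ≥0 → LeniaSpace n → LeniaSpace n,
      IsFlowOf F (leniaArcField K hK G hG.continuous) ∧
      (∀ F' : ℝ≥0 → LeniaSpace n → LeniaSpace n,
        IsFlowOf F' (leniaArcField K hK G hG.continuous) → F' = F) ∧
      ∀ (t : ℝ≥0) (f : LeniaSpace n),
        Tendsto (fun m : ℕ => eulerIterate (leniaArcField K hK G hG.continuous) t m f)
          atTop (𝓝 (F t f)) := by
  obtain ⟨C, B, Ω, hX⟩ :=
    exists_isUniformArcField_leniaArcField (hK := hK) (hGc := hG.continuous) hG
  exact ⟨inferInstance, hX.isArcField, hX.condE1, hX.condE2, eulerFlow _, hX.isFlowOf_eulerFlow,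
    fun _ hF' => hX.isFlowOf_eulerFlow.unique hX.lipschitzWith hF', hX.tendsto_eulerIterate⟩

theorem mainTheorem1 (n : ℕ) (K : EuclideanSpace ℝ (Fin n) → ℝ) (hK : Integrable K volume)
    (G : ℝ → ℝ) (L : ℝ≥0) (hG : LipschitzWith L G) (hGb : ∃ B : ℝ, ∀ y, |G y| ≤ B) :
    CompleteSpace (LeniaSpace n) ∧
    IsArcField (leniaArcField K hK G hG.continuous) ∧
    CondE1 (leniaArcField K hK G hG.continuous) ∧
    CondE2 (leniaArcField K hK G hG.continuous) ∧
    ∃ F : ℝ≥0 → LeniaSpace n → LeniaSpace n,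
      IsFlowOf F (leniaArcField K hK G hG.continuous) ∧
      (∀ F' : ℝ≥0 → LeniaSpace n → LeniaSpace n,
        IsFlowOf F' (leniaArcField K hK G hG.continuous) → F' = F) ∧
      ∀ (t : ℝ≥0) (f : LeniaSpace n),
        Tendsto (fun m : ℕ => eulerIterate (leniaArcField K hK G hG.continuous) t m f)
          atTop (𝓝 (F t f)) :=
  mainTheorem1_general n K hK G hG.locallyLipschitz
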